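/- Let $D$ be a (commutative) integral domain and let $\{X_\lambda\}_{\lambda\in\Lambda}$ be a nonempty (possibly infinite) set of indeterminates over $D$. Two elements $a,b$ of a commutative ring $R$ form an \emph{idempotent pair} if $(a\ b)$ or $(b\ a)$ is the first row of an idempotent $2\times 2$ matrix over $R$. An integral domain $R$ is a \emph{PRINC domain} if every ideal of $R$ generated by an idempotent pair is principal, and it is \emph{seminormal} if whenever $a,b\in R$ satisfy $a^2=b^3$, there is $c\in R$ with $c^3=a$ and $c^2=b$. Then the polynomial ring $D[\{X_\lambda\}_{\lambda\in\Lambda}]$ is a PRINC domain if and only if $D$ is a seminormal PRINC domain. -/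

import Mathlib

/-- Two elements `a`, `b` of a commutative ring form an *idempotent pair* if `(a b)` or `(b a)` is
the first row of an idempotent `2 × 2` matrix. -/
def IsIdempotentPair {R : Type*} [CommRing R] (a b : R) : Prop :=
  ∃ M : Matrix (Fin 2) (Fin 2) R, IsIdempotentElem M ∧
    ((M 0 0 = a ∧ M 0 1 = b) ∨ (M 0 0 = b ∧ M 0 1 = a))

/-- A *PRINC domain* is an integral domain in which every ideal generated by an idempotent pair
is principal. -/
structure IsPRINCDomain (R : Type*) [CommRing R] : Prop extends IsDomain R where
  isPrincipal_of_isIdempotentPair :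
    ∀ a b : R, IsIdempotentPair a b → (Ideal.span {a, b} : Ideal R).IsPrincipal

/-- An integral domain `R` is *seminormal* if whenever `a ^ 2 = b ^ 3` in `R`, there is `c` in `R`
with `c ^ 3 = a` and `c ^ 2 = b`. -/
structure IsSeminormalDomain (R : Type*) [CommRing R] : Prop extends IsDomain R where
  exists_of_sq_eq_cube :
    ∀ a b : R, a ^ 2 = b ^ 3 → ∃ c : R, c ^ 3 = a ∧ c ^ 2 = b

/-!
# Idempotent pairs in polynomial rings

Over a domain `R`, an idempotent `2 × 2` matrix is diagonal with entries `0`, `1` unless it has trace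
`1` and determinant `0`. For a matrix `M` of the latter kind, the ideal generated by the first row is
principal exactly when `M` is a column times a row, `M i j = x i * y j`. So `R` is a PRINC domain if
and only if every `M` of trace `1` and determinant `0` factors in this way
(`isPRINCDomain_iff_exists_factorization`).

Such a factorisation is unique up to a unit. In `MvPolynomial σ S` with `S` reduced the units are
constants, so the factorisation is determined by its constant terms
(`MvPolynomial.factorization_unique`). If `S` is a field, `MvPolynomial σ S` is factorial, and a
factorisation with prescribed constant terms exists (`MvPolynomial.exists_factorization_of_field`).

*Polynomial ring PRINC implies `D` seminormal PRINC.* `D` is a retract of the polynomial ring, so it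
is PRINC. If `a ^ 2 = b ^ 3` with `b ≠ 0`, put `c = a / b`, so that `c ^ 2 = b` and `c ^ 3 = a`. The
column `(1 + c X, c² X²)` times the row `((1 - c X) (1 + c² X²), c² X²)` has entries in `D[X]`; by
uniqueness its factorisation over `D` must be this one, and `c` is in `D`.

*`D` seminormal PRINC implies polynomial ring PRINC.* The matrix `M(0)` of constant terms factors
over `D`. Over the fraction field `K`, the matrix `M` factors into polynomials `x i`, `y j` whose
constant terms are those given over `D`. Their coefficients are integral over `D`, by Gauss' lemma
over the valuation rings of `K` containing `D` (`MvPolynomial.isIntegral_coeff_of_mul`), so they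
generate a subalgebra `B` of `K` that is finite over `D`. By seminormality the conductor `I` of `D`
in `B` is a radical ideal of `B`. Suppose that `I` is proper, and let `p` be a prime of `D` minimal
over `I ∩ D`. The localisation of `B / I` at `p` is a reduced algebra over the residue field of `p`;
comparing the image of the factorisation there with one over the residue field shows that each
coefficient is carried into `D` by some `s ∉ p`. As `B` is finite, some `s ∉ p` carries all of `B`
into `D`, so `s ∈ I ∩ D ⊆ p`, a contradiction. Hence `B = D`.
-/

open MvPolynomial

/-! ### Gauss' lemma over valuation rings -/

/-- A nonzero polynomial over the fraction field of a valuation ring is a constant times a polynomial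
over the valuation ring having some coefficient equal to `1`. -/
theorem ValuationSubring.exists_eq_C_mul_map {K σ : Type*} [Field K] (V : ValuationSubring K)
    {f : MvPolynomial σ K} (hf : f ≠ 0) :
    ∃ (t : K) (f' : MvPolynomial σ V), f = C t * map V.subtype f' ∧ ∃ i, f'.coeff i = 1 := by
  classical
  -- Divide by a coefficient of largest valuation.
  obtain ⟨i, hi, hmax⟩ := f.support.exists_max_image (fun i => V.valuation (f.coeff i))
    (by simpa using hf)
  have ht : f.coeff i ≠ 0 := by simpa using hi
  have hmem : C (f.coeff i)⁻¹ * f ∈ Set.range (map (σ := σ) V.subtype) := by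
    rw [mem_range_map_iff_coeffs_subset]
    intro x hx
    obtain ⟨j, hj, rfl⟩ := mem_coeffs_iff.1 (Finset.mem_coe.1 hx)
    have hj' : j ∈ f.support := by
      rw [mem_support_iff, coeff_C_mul] at hj
      exact mem_support_iff.2 (right_ne_zero_of_mul hj)
    refine ⟨⟨_, (V.valuation_le_one_iff _).1 ?_⟩, rfl⟩
    change V.valuation (coeff j (C _ * f)) ≤ 1
    rw [coeff_C_mul, map_mul, map_inv₀, inv_mul_le_one₀]
    · exact hmax j hj'
    · simpa [zero_lt_iff] using ht
  obtain ⟨f', hf'⟩ := hmem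
  refine ⟨f.coeff i, f', ?_, i, ?_⟩
  · rw [hf', ← mul_assoc, ← C_mul, mul_inv_cancel₀ ht, C_1, one_mul]
  · apply V.subtype_injective
    rw [← coeff_map, hf', coeff_C_mul, inv_mul_cancel₀ ht, map_one]

/-- Primitive times primitive is primitive, because the polynomials over the residue field form a
domain. -/
theorem ValuationSubring.exists_coeff_mul_eq_unit {K σ : Type*} [Field K] (V : ValuationSubring K)
    {f g : MvPolynomial σ V} (hf : ∃ i, f.coeff i = 1) (hg : ∃ i, g.coeff i = 1) :
    ∃ i, IsUnit ((f * g).coeff i) := by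
  by_contra! hcon
  have hne : ∀ p : MvPolynomial σ V, (∃ i, p.coeff i = 1) →
      map (IsLocalRing.residue V) p ≠ 0 := by
    rintro p ⟨i, hi⟩ h0
    have := congrArg (coeff i) h0
    simp [coeff_map, hi] at this
  refine mul_ne_zero (hne f hf) (hne g hg) ?_
  rw [← map_mul]
  ext i
  rw [coeff_map, coeff_zero, IsLocalRing.residue_eq_zero_iff]
  exact hcon i

/-- A form of Gauss' lemma: since `g` has constant term `1`, its content is at least that of `1`, so
`f` has content at most that of `f * g`. -/
theorem ValuationSubring.coeff_mem_of_mul {K σ : Type*} [Field K] (V : ValuationSubring K)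
    {f g : MvPolynomial σ K} (hfg : ∀ i, (f * g).coeff i ∈ V) (hg : constantCoeff g = 1)
    (i : σ →₀ ℕ) : f.coeff i ∈ V := by
  by_cases hf0 : f = 0
  · simp [hf0, V.zero_mem]
  have hg0 : g ≠ 0 := by rintro rfl; simp at hg
  obtain ⟨t, f', rfl, hf'⟩ := V.exists_eq_C_mul_map hf0
  obtain ⟨s, g', rfl, hg'⟩ := V.exists_eq_C_mul_map hg0
  obtain ⟨j, hj⟩ := V.exists_coeff_mul_eq_unit hf' hg'
  have hst : s * t ∈ V := by
    obtain ⟨w, hw⟩ := hj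
    have h1 := hfg j
    rw [show C t * map V.subtype f' * (C s * map V.subtype g')
      = C (s * t) * map V.subtype (f' * g') by simp only [map_mul]; ring, coeff_C_mul,
      coeff_map, ← hw] at h1
    have h2 : ((w : V) : K) * ((w⁻¹ : Vˣ) : V) = 1 := by
      exact_mod_cast congrArg (Subtype.val) w.mul_inv
    have h3 := V.mul_mem _ _ h1 ((w⁻¹ : Vˣ) : V).2
    rwa [mul_assoc, show V.subtype (w : V) = ((w : V) : K) from rfl, h2, mul_one] at h3
  have hsg : s * (constantCoeff g' : V) = 1 := by
    simpa [constantCoeff_map] using hg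
  have ht : t ∈ V := by
    have : t = s * t * (constantCoeff g' : V) := by linear_combination -t * hsg
    rw [this]
    exact V.mul_mem _ _ hst (SetLike.coe_mem _)
  rw [coeff_C_mul, coeff_map]
  exact V.mul_mem _ _ ht (SetLike.coe_mem _)

/-- The integral closure of `R` in `K` is the intersection of the valuation rings of `K` containing
`R`, so Gauss' lemma for valuation rings gives a statement about integrality. -/
theorem MvPolynomial.isIntegral_coeff_of_mul {R K σ : Type*} [CommRing R] [Field K] [Algebra R K]
    {f g : MvPolynomial σ K} (hfg : ∀ i, IsIntegral R ((f * g).coeff i))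
    (hg : constantCoeff g = 1) (i : σ →₀ ℕ) : IsIntegral R (f.coeff i) := by
  let A := integralClosure R K
  have : IsIntegrallyClosedIn A.toSubring K := inferInstanceAs (IsIntegrallyClosedIn A K)
  suffices h : f.coeff i ∈ A.toSubring from h
  rw [Subring.eq_iInf_of_isIntegrallyClosedIn (R := A.toSubring)]
  simp only [Subring.mem_iInf]
  intro V
  exact V.1.coeff_mem_of_mul (fun j => V.2 (hfg j)) hg i

/-! ### Factorisation of rank one idempotent matrices -/

theorem exists_factorization_of_isPrincipal {R : Type*} [CommRing R] [IsDomain R]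
    {M : Matrix (Fin 2) (Fin 2) R} (hdet : M.det = 0)
    (h : (Ideal.span {M 0 0, M 0 1} : Ideal R).IsPrincipal) :
    ∃ x y : Fin 2 → R, ∀ i j, M i j = x i * y j := by
  rw [Matrix.det_fin_two] at hdet
  obtain ⟨g, hg⟩ := h
  rw [← Ideal.span] at hg
  obtain ⟨u, hu⟩ : g ∣ M 0 0 := by
    rw [← Ideal.mem_span_singleton, ← hg]; exact Ideal.subset_span (by simp)
  obtain ⟨v, hv⟩ : g ∣ M 0 1 := by
    rw [← Ideal.mem_span_singleton, ← hg]; exact Ideal.subset_span (by simp)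
  obtain ⟨r, s, hrs⟩ : ∃ r s, r * M 0 0 + s * M 0 1 = g :=
    Ideal.mem_span_pair.1 (hg ▸ Ideal.mem_span_singleton_self g)
  by_cases hg0 : g = 0
  · refine ⟨![0, 1], ![M 1 0, M 1 1], fun i j => ?_⟩
    fin_cases i <;> fin_cases j <;> simp [hu, hv, hg0]
  have h1 : r * u + s * v = 1 := mul_left_cancel₀ hg0 (by
    linear_combination hrs - r * hu - s * hv)
  have h2 : u * M 1 1 = v * M 1 0 := mul_left_cancel₀ hg0 (by
    linear_combination hdet - M 1 1 * hu + M 1 0 * hv)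
  -- The second entry `w` of the column is forced by `u * w = M 1 0`, `v * w = M 1 1` and
  -- `r * u + s * v = 1`.
  refine ⟨![g, r * M 1 0 + s * M 1 1], ![u, v], fun i j => ?_⟩
  fin_cases i <;> fin_cases j <;> simp
  · exact hu
  · exact hv
  · linear_combination -M 1 0 * h1 - s * h2
  · linear_combination -M 1 1 * h1 + r * h2

/-- For a matrix of trace `1` and determinant `0`, a factorisation `M i j = x i * y j` makes the first
row generate the ideal `(x 0)`, since `1 = x 0 * y 0 + x 1 * y 1`; the converse is
`exists_factorization_of_isPrincipal`. -/
theorem isPRINCDomain_iff_exists_factorization {R : Type*} [CommRing R] [IsDomain R] :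
    IsPRINCDomain R ↔ ∀ M : Matrix (Fin 2) (Fin 2) R, M.trace = 1 → M.det = 0 →
      ∃ x y : Fin 2 → R, ∀ i j, M i j = x i * y j := by
  refine ⟨fun hR M htr hdet => ?_, fun H => { isPrincipal_of_isIdempotentPair := ?_ }⟩
  · refine exists_factorization_of_isPrincipal hdet
      (hR.isPrincipal_of_isIdempotentPair _ _ ⟨M, ?_, Or.inl ⟨rfl, rfl⟩⟩)
    rw [Matrix.trace_fin_two] at htr
    rw [Matrix.det_fin_two] at hdet
    ext i j
    rw [Matrix.mul_apply, Fin.sum_univ_two]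
    fin_cases i <;> fin_cases j <;> simp
    · linear_combination M 0 0 * htr - hdet
    · linear_combination M 0 1 * htr
    · linear_combination M 1 0 * htr
    · linear_combination M 1 1 * htr - hdet
  · have key : ∀ M : Matrix (Fin 2) (Fin 2) R, IsIdempotentElem M →
        (Ideal.span {M 0 0, M 0 1} : Ideal R).IsPrincipal := by
      intro M hM
      have hM' : ∀ i j, M i 0 * M 0 j + M i 1 * M 1 j = M i j := fun i j => by
        rw [← Fin.sum_univ_two (fun k => M i k * M k j), ← Matrix.mul_apply, hM.eq]
      have h00 := hM' 0 0
      have h01 := hM' 0 1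
      have h10 := hM' 1 0
      have h11 := hM' 1 1
      by_cases ht : M 0 0 + M 1 1 = 1
      · obtain ⟨x, y, hxy⟩ := H M (by rw [Matrix.trace_fin_two, ht])
          (by rw [Matrix.det_fin_two]; linear_combination M 0 0 * ht - h00)
        refine ⟨x 0, ?_⟩
        rw [← Ideal.span]
        apply le_antisymm
        · rw [Ideal.span_le]
          rintro z (rfl | rfl) <;>
          · rw [SetLike.mem_coe, Ideal.mem_span_singleton, hxy]
            exact dvd_mul_right _ _
        · rw [Ideal.span_singleton_le_iff_mem, Ideal.mem_span_pair]
          refine ⟨x 0, x 1, ?_⟩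
          rw [hxy, hxy] at *
          linear_combination x 0 * ht
      · -- If the trace is not `1` then the matrix has first row `(0, 0)` or `(1, 0)`.
        have hb : M 0 1 = 0 := (mul_eq_zero.1 (show M 0 1 * (M 0 0 + M 1 1 - 1) = 0 by
          linear_combination h01)).resolve_right (sub_ne_zero.2 ht)
        have ha : M 0 0 * (M 0 0 - 1) = 0 := by linear_combination h00 - M 1 0 * hb
        rcases mul_eq_zero.1 ha with ha | ha
        · rw [ha, hb]; exact ⟨0, by simp [Ideal.span]⟩
        · rw [sub_eq_zero.1 ha, hb]
          refine ⟨1, ?_⟩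
          rw [← Ideal.span, Ideal.span_singleton_one, Ideal.eq_top_iff_one]
          exact Ideal.subset_span (by simp)
    rintro a b ⟨M, hM, ⟨rfl, rfl⟩ | ⟨rfl, rfl⟩⟩
    · exact key M hM
    · rw [Set.pair_comm]; exact key M hM

/-- Over a factorial ring, the column starts with a greatest common divisor of the first row. -/
theorem exists_factorization_of_uniqueFactorizationMonoid {R : Type*} [CommRing R] [IsDomain R]
    [UniqueFactorizationMonoid R] {M : Matrix (Fin 2) (Fin 2) R} (hdet : M.det = 0) :
    ∃ x y : Fin 2 → R, ∀ i j, M i j = x i * y j := by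
  rw [Matrix.det_fin_two] at hdet
  by_cases h0 : M 0 0 = 0 ∧ M 0 1 = 0
  · refine ⟨![0, 1], ![M 1 0, M 1 1], fun i j => ?_⟩
    fin_cases i <;> fin_cases j <;> simp [h0]
  obtain ⟨u, v, g, huv, hg0, hu, hv⟩ : ∃ u v g : R, IsRelPrime u v ∧ g ≠ 0 ∧ g * u = M 0 0 ∧
      g * v = M 0 1 := by
    rcases not_and_or.1 h0 with h | h
    · obtain ⟨u, v, g, huv, hu, hv⟩ :=
        UniqueFactorizationMonoid.exists_reduced_factors (M 0 0) h (M 0 1)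
      exact ⟨u, v, g, huv, left_ne_zero_of_mul (hu ▸ h), hu, hv⟩
    · obtain ⟨v, u, g, huv, hv, hu⟩ :=
        UniqueFactorizationMonoid.exists_reduced_factors (M 0 1) h (M 0 0)
      exact ⟨u, v, g, huv.symm, left_ne_zero_of_mul (hv ▸ h), hu, hv⟩
  have h2 : u * M 1 1 = v * M 1 0 := mul_left_cancel₀ hg0 (by
    linear_combination hdet + M 1 1 * hu - M 1 0 * hv)
  have key : ∃ w, M 1 0 = u * w ∧ M 1 1 = v * w := by
    by_cases hu0 : u = 0
    · obtain ⟨v', hv'⟩ : IsUnit v := huv (hu0 ▸ dvd_zero v) dvd_rfl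
      refine ⟨(v'⁻¹ : Rˣ) * M 1 1, ?_, ?_⟩
      · rw [hu0, zero_mul, ← hv'] at h2
        rw [hu0, zero_mul]
        exact (Units.mul_right_eq_zero v').1 h2.symm
      · rw [← mul_assoc, ← hv', Units.mul_inv, one_mul]
    · obtain ⟨w, hw⟩ := huv.dvd_of_dvd_mul_left (Dvd.intro _ h2)
      exact ⟨w, hw, mul_left_cancel₀ hu0 (by rw [h2, hw]; ring)⟩
  obtain ⟨w, hw0, hw1⟩ := key
  refine ⟨![g, w], ![u, v], fun i j => ?_⟩
  fin_cases i <;> fin_cases j <;> simp [hu, hv, hw0, hw1, mul_comm]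

/-- A factorisation of a rank one idempotent is unique up to a unit; over a reduced ring the units
of the polynomial ring are constants, so the constant terms determine the factorisation. -/
theorem MvPolynomial.factorization_unique {S σ ι : Type*} [CommRing S] [IsReduced S] [Fintype ι]
    {x y x' y' : ι → MvPolynomial σ S} (h : ∀ i j, x i * y j = x' i * y' j)
    (h1 : ∑ i, x i * y i = 1)
    (h0 : ∀ i, constantCoeff (x i) = constantCoeff (x' i)) : x = x' ∧ y = y' := by
  have h1' : ∑ i, x' i * y' i = 1 := by simpa only [h] using h1
  -- `x = t * x'` and `y = s * y'` with `t * s = 1`.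
  obtain ⟨t, ht⟩ : ∃ t, t = ∑ j, x j * y' j := ⟨_, rfl⟩
  obtain ⟨s, hs⟩ : ∃ s, s = ∑ j, x' j * y j := ⟨_, rfl⟩
  have hx : ∀ i, x i = t * x' i := fun i => by
    rw [← mul_one (x i), ← h1, ht, Finset.mul_sum, Finset.sum_mul]
    exact Finset.sum_congr rfl fun j _ => by linear_combination x j * h i j
  have hy : ∀ i, y i = s * y' i := fun i => by
    rw [← mul_one (y i), ← h1, hs, Finset.mul_sum, Finset.sum_mul]
    exact Finset.sum_congr rfl fun j _ => by linear_combination y j * h j i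
  have hts : t * s = 1 := by
    calc t * s = t * s * ∑ i, x' i * y' i := by rw [h1', mul_one]
      _ = ∑ i, x i * y i := by
        rw [Finset.mul_sum]
        exact Finset.sum_congr rfl fun i _ => by rw [hx i, hy i]; ring
      _ = 1 := h1
  have hone : constantCoeff t = 1 := by
    rw [ht, ← map_one constantCoeff, ← h1', map_sum, map_sum]
    simp only [map_mul, h0]
  have ht1 : t = 1 := by
    obtain ⟨r, -, hC⟩ := isUnit_iff_eq_C_of_isReduced.1 (IsUnit.of_mul_eq_one s hts)
    rw [hC] at hone ⊢
    rw [constantCoeff_C] at hone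
    rw [hone, C_1]
  have hs1 : s = 1 := by rw [ht1, one_mul] at hts; exact hts
  exact ⟨_root_.funext fun i => by rw [hx i, ht1, one_mul],
    _root_.funext fun i => by rw [hy i, hs1, one_mul]⟩

/-! ### Normalised factorisations and integrality of their coefficients -/

/-- A factorisation can be rescaled by constants so that its constant terms form any given
factorisation of the matrix of constant terms. -/
theorem MvPolynomial.exists_factorization_constantCoeff_eq {R σ ι : Type*} [CommRing R] [Fintype ι]
    {x y : ι → MvPolynomial σ R} {x₀ y₀ : ι → R}
    (h : ∀ i j, constantCoeff (x i * y j) = x₀ i * y₀ j) (h1 : ∑ i, x₀ i * y₀ i = 1) :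
    ∃ x' y' : ι → MvPolynomial σ R, (∀ i j, x' i * y' j = x i * y j) ∧
      (∀ i, constantCoeff (x' i) = x₀ i) ∧ ∀ i, constantCoeff (y' i) = y₀ i := by
  simp only [map_mul] at h
  obtain ⟨t, ht⟩ : ∃ t, t = ∑ j, constantCoeff (x j) * y₀ j := ⟨_, rfl⟩
  obtain ⟨s, hs⟩ : ∃ s, s = ∑ j, x₀ j * constantCoeff (y j) := ⟨_, rfl⟩
  have hx : ∀ i, s * constantCoeff (x i) = x₀ i := fun i => by
    rw [← mul_one (x₀ i), ← h1, hs, Finset.mul_sum, Finset.sum_mul]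
    exact Finset.sum_congr rfl fun j _ => by linear_combination x₀ j * h i j
  have hy : ∀ i, t * constantCoeff (y i) = y₀ i := fun i => by
    rw [← mul_one (y₀ i), ← h1, ht, Finset.mul_sum, Finset.sum_mul]
    exact Finset.sum_congr rfl fun j _ => by linear_combination y₀ j * h j i
  have hst : s * t = 1 := by
    rw [ht, Finset.mul_sum, ← h1]
    exact Finset.sum_congr rfl fun i _ => by rw [← mul_assoc, hx]
  refine ⟨fun i => C s * x i, fun i => C t * y i, fun i j => ?_, fun i => ?_, fun i => ?_⟩
  · have : (C s * C t : MvPolynomial σ R) = 1 := by rw [← C_mul, hst, C_1]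
    linear_combination x i * y j * this
  · simp [hx]
  · simp [hy]

theorem MvPolynomial.exists_factorization_of_field {k σ : Type*} [Field k]
    {M : Matrix (Fin 2) (Fin 2) (MvPolynomial σ k)} (hdet : M.det = 0) {x₀ y₀ : Fin 2 → k}
    (h : ∀ i j, constantCoeff (M i j) = x₀ i * y₀ j) (h1 : ∑ i, x₀ i * y₀ i = 1) :
    ∃ x y : Fin 2 → MvPolynomial σ k, (∀ i j, M i j = x i * y j) ∧
      (∀ i, constantCoeff (x i) = x₀ i) ∧ ∀ i, constantCoeff (y i) = y₀ i := by
  obtain ⟨x, y, hxy⟩ := exists_factorization_of_uniqueFactorizationMonoid hdet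
  obtain ⟨x', y', h', hx, hy⟩ :=
    exists_factorization_constantCoeff_eq (x := x) (y := y) (fun i j => by rw [← hxy, h]) h1
  exact ⟨x', y', fun i j => by rw [h', hxy], hx, hy⟩

/-- The linear combination `∑ j, x₀ j * y j` has constant term `1`, and its product with `x i` has
coefficients in `R`, so `MvPolynomial.isIntegral_coeff_of_mul` applies. The companion statement for
`y` follows by transposing. -/
theorem MvPolynomial.isIntegral_coeff_of_factorization {R K σ ι : Type*} [CommRing R] [Field K]
    [Algebra R K] [Fintype ι] {m : ι → ι → MvPolynomial σ R} {x y : ι → MvPolynomial σ K}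
    {x₀ y₀ : ι → R} (h : ∀ i j, x i * y j = map (algebraMap R K) (m i j))
    (hy : ∀ i, constantCoeff (y i) = algebraMap R K (y₀ i)) (h1 : ∑ i, x₀ i * y₀ i = 1)
    (i : ι) (n : σ →₀ ℕ) : IsIntegral R ((x i).coeff n) := by
  refine isIntegral_coeff_of_mul (g := ∑ j, C (algebraMap R K (x₀ j)) * y j) (fun n => ?_) ?_ n
  · have : x i * ∑ j, C (algebraMap R K (x₀ j)) * y j =
        map (algebraMap R K) (∑ j, C (x₀ j) * m i j) := by
      rw [map_sum, Finset.mul_sum]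
      refine Finset.sum_congr rfl fun j _ => ?_
      rw [map_mul, map_C, ← h]
      ring
    rw [this, coeff_map]
    exact isIntegral_algebraMap
  · simp only [map_sum, map_mul, constantCoeff_C, hy]
    simp only [← map_mul, ← map_sum, h1, map_one]

/-! ### Minimal primes over radical ideals -/

/-- At a prime `p` minimal over a radical ideal `I`, the localisations of `p` and `I` agree. -/
theorem Ideal.IsRadical.exists_mul_mem_of_mem_minimalPrimes {R : Type*} [CommRing R]
    {I p : Ideal R} (hI : I.IsRadical) (hp : p ∈ I.minimalPrimes) {x : R} (hx : x ∈ p) :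
    ∃ s ∉ p, s * x ∈ I := by
  have := hp.isPrime
  by_contra! hcon
  -- Otherwise `I` avoids the monoid generated by `x` and the complement of `p`, and a prime over `I`
  -- avoiding this monoid is strictly smaller than `p`.
  obtain ⟨q, hq, hIq, hdisj⟩ := I.exists_le_prime_disjoint (p.primeCompl ⊔ Submonoid.powers x) (by
    rw [Set.disjoint_left]
    rintro z hz hz'
    obtain ⟨s, hs, w, ⟨n, rfl⟩, rfl⟩ := Submonoid.mem_sup.1 hz'
    refine hcon s hs (hI ⟨n + 1, ?_⟩)
    rw [show (s * x) ^ (n + 1) = s ^ n * x * (s * x ^ n) by ring]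
    exact I.mul_mem_left _ hz)
  rw [Set.disjoint_left] at hdisj
  have hqp : q ≤ p := fun z hz => by
    by_contra hzp
    exact hdisj hz (Submonoid.mem_sup_left (show z ∈ p.primeCompl from hzp))
  exact hdisj (hp.2 ⟨hq, hIq⟩ hqp hx) (Submonoid.mem_sup_right (Submonoid.mem_powers x))

/-! ### The conductor of a subalgebra -/

section Conductor

variable {D K : Type*} [CommRing D] [Field K] [Algebra D K]
/-- The conductor of `D` in a subalgebra `B` of a field `K` over `D`: the largest ideal of `B` contained in
the image of `D`, which is written as the bottom subalgebra of `K`. -/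
def Subalgebra.conductor (B : Subalgebra D K) : Ideal B where
  carrier := {x | ∀ b : B, (x * b : K) ∈ (⊥ : Subalgebra D K)}
  add_mem' {x y} hx hy b := by
    rw [Subalgebra.coe_add, add_mul]
    exact add_mem (hx b) (hy b)
  zero_mem' b := by simp
  smul_mem' c x hx b := by
    have := hx (c * b)
    rwa [smul_eq_mul, Subalgebra.coe_mul, mul_comm (c : K), mul_assoc]

theorem Subalgebra.mem_conductor {B : Subalgebra D K} {x : B} :
    x ∈ B.conductor ↔ ∀ b : B, (x * b : K) ∈ (⊥ : Subalgebra D K) := Iff.rfl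

/-- Seminormality in terms of an overfield: an element whose square and cube lie in `D` is in `D`. -/
theorem IsSeminormalDomain.mem_bot [FaithfulSMul D K] (hD : IsSeminormalDomain D)
    {z : K} (h2 : z ^ 2 ∈ (⊥ : Subalgebra D K)) (h3 : z ^ 3 ∈ (⊥ : Subalgebra D K)) :
    z ∈ (⊥ : Subalgebra D K) := by
  obtain ⟨b, hb⟩ := Algebra.mem_bot.1 h2
  obtain ⟨a, ha⟩ := Algebra.mem_bot.1 h3
  have hinj := FaithfulSMul.algebraMap_injective D K
  obtain ⟨c, rfl, rfl⟩ := hD.exists_of_sq_eq_cube a b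
    (hinj (by rw [map_pow, map_pow, ha, hb]; ring))
  rw [map_pow] at ha hb
  refine Algebra.mem_bot.2 ⟨c, ?_⟩
  by_cases hz : z = 0
  · rw [hz, zero_pow two_ne_zero, sq_eq_zero_iff] at hb
    rw [hb, hz]
  · refine mul_left_cancel₀ (pow_ne_zero 2 hz) ?_
    rw [← pow_succ, ← ha, ← hb, ← pow_succ]

/-- If `x ^ 2` is in the conductor, then for `b` in `B` the elements `(x * b) ^ 2` and
`(x * b) ^ 3 = x ^ 2 * (x * b ^ 3)` lie in `D`, hence so does `x * b`. -/
theorem IsSeminormalDomain.isReduced_quotient_conductor [FaithfulSMul D K]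
    (hD : IsSeminormalDomain D) (B : Subalgebra D K) : IsReduced (B ⧸ B.conductor) := by
  rw [isReduced_iff_pow_one_lt 2 one_lt_two]
  intro x hx
  obtain ⟨x, rfl⟩ := Ideal.Quotient.mk_surjective x
  rw [← map_pow, Ideal.Quotient.eq_zero_iff_mem] at hx
  rw [Ideal.Quotient.eq_zero_iff_mem]
  intro b
  apply hD.mem_bot
  · have := hx (b ^ 2)
    rw [mul_pow]; exact_mod_cast this
  · have := hx (x * b ^ 3)
    convert this using 1
    push_cast; ring

/-! ### Descent along the conductor -/

/-- Descent to a residue field. If the localisation `L` of `Q` at `p` is a reduced ring in which `p`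
vanishes, then it is an algebra over the residue field of `p`. By uniqueness, the factorisation
over `Q` and the one over the residue field agree in `L`, so each coefficient is a fraction of
elements of `D`. -/
theorem MvPolynomial.exists_smul_coeff_eq_of_isLocalization {D Q σ : Type*} (L : Type*)
    [CommRing D] [CommRing Q] [CommRing L] [Algebra D Q] [Algebra Q L] [IsReduced L]
    {p : Ideal D} [p.IsPrime] [IsLocalization (Algebra.algebraMapSubmonoid Q p.primeCompl) L]
    (hp : ∀ r ∈ p, ∃ s ∉ p, algebraMap D Q (s * r) = 0)
    {M : Matrix (Fin 2) (Fin 2) (MvPolynomial σ D)} (hdet : M.det = 0) (htr : M.trace = 1)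
    {x₀ y₀ : Fin 2 → D} (h₀ : ∀ i j, constantCoeff (M i j) = x₀ i * y₀ j)
    {x y : Fin 2 → MvPolynomial σ Q} (h : ∀ i j, x i * y j = map (algebraMap D Q) (M i j))
    (hx : ∀ i, constantCoeff (x i) = algebraMap D Q (x₀ i)) (i : Fin 2) (n : σ →₀ ℕ) :
    ∃ s ∉ p, ∃ d, s • (x i).coeff n = algebraMap D Q d := by
  let f : D →+* L := (algebraMap Q L).comp (algebraMap D Q)
  have hunit : ∀ s ∉ p, IsUnit (f s) := fun s hs =>
    IsLocalization.map_units L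
      (⟨algebraMap D Q s, s, hs, rfl⟩ : Algebra.algebraMapSubmonoid Q p.primeCompl)
  have hker : p ≤ RingHom.ker f := fun r hr => by
    obtain ⟨s, hs, hsr⟩ := hp r hr
    have h0 : f (s * r) = 0 := by rw [RingHom.comp_apply, hsr, map_zero]
    rw [map_mul] at h0
    exact (hunit s hs).mul_right_eq_zero.1 h0
  let ψ : p.ResidueField →+* L := Ideal.ResidueField.lift p f hker hunit
  have hψ : ∀ r, ψ (algebraMap D p.ResidueField r) = f r :=
    Ideal.ResidueField.lift_algebraMap p f hker hunit
  have hψ' : ψ.comp (algebraMap D p.ResidueField) = f := RingHom.ext hψ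
  have hsum : ∑ i, x₀ i * y₀ i = 1 := by
    rw [Matrix.trace_fin_two] at htr
    rw [Fin.sum_univ_two, ← h₀, ← h₀, ← map_add, htr, map_one]
  have hsumM : M 0 0 + M 1 1 = 1 := by rw [← htr, Matrix.trace_fin_two]
  obtain ⟨x', y', hxy', hx', -⟩ := exists_factorization_of_field
    (M := M.map (map (algebraMap D p.ResidueField)))
    (x₀ := fun i => algebraMap D p.ResidueField (x₀ i))
    (y₀ := fun i => algebraMap D p.ResidueField (y₀ i))
    (by rw [← RingHom.mapMatrix_apply, ← RingHom.map_det, hdet, map_zero])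
    (fun i j => by rw [Matrix.map_apply, constantCoeff_map, h₀, map_mul])
    (by simp only [← map_mul, ← map_sum, hsum, map_one])
  have huniq := (factorization_unique
    (x := fun i => map (algebraMap Q L) (x i)) (y := fun i => map (algebraMap Q L) (y i))
    (x' := fun i => map ψ (x' i)) (y' := fun i => map ψ (y' i))
    (fun i j => by
      rw [← map_mul, ← map_mul, h, ← hxy', Matrix.map_apply, map_map, map_map, hψ'])
    (by
      simp only [← map_mul, h, map_map, Fin.sum_univ_two]
      rw [← map_add, hsumM, map_one])
    (fun i => by rw [constantCoeff_map, constantCoeff_map, hx, hx', hψ]; rfl)).1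
  have hc : algebraMap Q L ((x i).coeff n) = ψ ((x' i).coeff n) := by
    rw [← coeff_map, ← coeff_map]
    exact congrArg (coeff n) (congrFun huniq i)
  obtain ⟨a, b, hb, hab⟩ := IsFractionRing.div_surjective (D ⧸ p) ((x' i).coeff n)
  obtain ⟨d, rfl⟩ := Ideal.Quotient.mk_surjective a
  obtain ⟨s, rfl⟩ := Ideal.Quotient.mk_surjective b
  have hs : s ∉ p := fun hs => nonZeroDivisors.ne_zero hb (Ideal.Quotient.eq_zero_iff_mem.2 hs)
  have hs0 : algebraMap D p.ResidueField s ≠ 0 := by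
    rwa [Ne, Ideal.algebraMap_residueField_eq_zero]
  have hab' : algebraMap D p.ResidueField s * (x' i).coeff n = algebraMap D p.ResidueField d := by
    rw [← hab]
    exact mul_div_cancel₀ _ hs0
  have heq : algebraMap Q L (algebraMap D Q s * (x i).coeff n) =
      algebraMap Q L (algebraMap D Q d) := by
    change _ = f d
    rw [map_mul, hc, ← hψ d, ← hab', map_mul, hψ]
    rfl
  obtain ⟨⟨_, t, ht, rfl⟩, hte⟩ := (IsLocalization.eq_iff_exists
    (Algebra.algebraMapSubmonoid Q p.primeCompl) L).1 heq
  refine ⟨t * s, p.primeCompl.mul_mem ht hs, t * d, ?_⟩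
  rw [Algebra.smul_def, map_mul, map_mul, mul_assoc]
  exact hte

/-- The previous theorem applied to `Q = B / I`, where `I` is the conductor, and lifted back to `B`: an
element of `B` congruent modulo `I` to an element of `D` lies in `D`. -/
theorem IsSeminormalDomain.exists_smul_coeff_mem_bot [FaithfulSMul D K] {σ : Type*}
    (hD : IsSeminormalDomain D) {B : Subalgebra D K} {p : Ideal D}
    (hp : p ∈ (B.conductor.comap (algebraMap D B)).minimalPrimes)
    {M : Matrix (Fin 2) (Fin 2) (MvPolynomial σ D)} (hdet : M.det = 0) (htr : M.trace = 1)
    {x₀ y₀ : Fin 2 → D} (h₀ : ∀ i j, constantCoeff (M i j) = x₀ i * y₀ j)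
    {x y : Fin 2 → MvPolynomial σ B}
    (h : ∀ i j, x i * y j = map (algebraMap D B) (M i j))
    (hx : ∀ i, constantCoeff (x i) = algebraMap D B (x₀ i)) (i : Fin 2) (n : σ →₀ ℕ) :
    ∃ s ∉ p, s • (((x i).coeff n : B) : K) ∈ (⊥ : Subalgebra D K) := by
  have := hp.isPrime
  have := hD.isReduced_quotient_conductor B
  have hrad : (B.conductor.comap (algebraMap D B)).IsRadical :=
    ((Ideal.isRadical_iff_quotient_reduced _).2 inferInstance).comap _
  have hmk : (Ideal.Quotient.mk B.conductor).comp (algebraMap D B) =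
      algebraMap D (B ⧸ B.conductor) := rfl
  have hmk' : ∀ r, Ideal.Quotient.mk B.conductor (algebraMap D B r) =
      algebraMap D (B ⧸ B.conductor) r := fun _ => rfl
  obtain ⟨s, hs, d, hsd⟩ := exists_smul_coeff_eq_of_isLocalization
    (Localization (Algebra.algebraMapSubmonoid (B ⧸ B.conductor) p.primeCompl))
    (fun r hr => by
      obtain ⟨s, hs, hsr⟩ := hrad.exists_mul_mem_of_mem_minimalPrimes hp hr
      exact ⟨s, hs, by rw [← hmk', Ideal.Quotient.eq_zero_iff_mem.2 (Ideal.mem_comap.1 hsr)]⟩)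
    hdet htr h₀
    (x := fun i => map (Ideal.Quotient.mk B.conductor) (x i))
    (y := fun i => map (Ideal.Quotient.mk B.conductor) (y i))
    (fun i j => by rw [← map_mul, h, map_map, hmk])
    (fun i => by rw [constantCoeff_map, hx, hmk']) i n
  rw [coeff_map, Algebra.smul_def, ← hmk', ← hmk', ← map_mul, Ideal.Quotient.eq,
    Subalgebra.mem_conductor] at hsd
  refine ⟨s, hs, ?_⟩
  convert add_mem (hsd 1) (Subalgebra.algebraMap_mem (⊥ : Subalgebra D K) d) using 1
  simp [Algebra.smul_def]

/-- Denominators outside `p` for the generators of a finite algebra give a common denominator outside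
`p` for the whole algebra. -/
theorem Subalgebra.exists_notMem_mem_conductor {T : Set K} (hT : T.Finite)
    (hint : ∀ c ∈ T, IsIntegral D c) (p : Ideal D) [p.IsPrime]
    (hs : ∀ c ∈ T, ∃ s ∉ p, s • c ∈ (⊥ : Subalgebra D K)) :
    ∃ s ∉ p, algebraMap D (Algebra.adjoin D T) s ∈ (Algebra.adjoin D T).conductor := by
  have hall : ∀ b ∈ Algebra.adjoin D T, ∃ s ∉ p, s • b ∈ (⊥ : Subalgebra D K) := by
    intro b hb
    induction hb using Algebra.adjoin_induction with
    | mem c hc => exact hs c hc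
    | algebraMap r =>
      exact ⟨1, p.primeCompl.one_mem, by rw [one_smul]; exact Subalgebra.algebraMap_mem _ r⟩
    | add b c _ _ hb hc =>
      obtain ⟨s, hs, hsb⟩ := hb
      obtain ⟨t, ht, htc⟩ := hc
      refine ⟨s * t, p.primeCompl.mul_mem hs ht, ?_⟩
      rw [smul_add, mul_smul s t c, mul_comm, mul_smul]
      exact add_mem (Subalgebra.smul_mem _ hsb _) (Subalgebra.smul_mem _ htc _)
    | mul b c _ _ hb hc =>
      obtain ⟨s, hs, hsb⟩ := hb
      obtain ⟨t, ht, htc⟩ := hc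
      refine ⟨s * t, p.primeCompl.mul_mem hs ht, ?_⟩
      rw [← smul_mul_smul_comm]
      exact mul_mem hsb htc
  obtain ⟨G, hG⟩ := fg_adjoin_of_finite hT hint
  have hGB : ∀ c ∈ G, c ∈ Algebra.adjoin D T := fun c hc => by
    rw [← Subalgebra.mem_toSubmodule, ← hG]; exact Submodule.subset_span hc
  have hprod : ∃ s ∉ p, ∀ c ∈ G, s • c ∈ (⊥ : Subalgebra D K) := by
    clear hG
    induction G using Finset.cons_induction with
    | empty => exact ⟨1, p.primeCompl.one_mem, by simp⟩
    | cons c G hcG ih =>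
      obtain ⟨s, hs, hsG⟩ := ih fun c hc => hGB c (Finset.mem_cons_of_mem hc)
      obtain ⟨t, ht, htc⟩ := hall c (hGB c (Finset.mem_cons_self c G))
      refine ⟨s * t, p.primeCompl.mul_mem hs ht, fun e he => ?_⟩
      rcases Finset.mem_cons.1 he with rfl | he
      · rw [mul_smul]; exact Subalgebra.smul_mem _ htc _
      · rw [mul_comm, mul_smul]; exact Subalgebra.smul_mem _ (hsG e he) _
  obtain ⟨s, hs, hsG⟩ := hprod
  refine ⟨s, hs, fun ⟨b, hb⟩ => ?_⟩
  replace hb : b ∈ Submodule.span D (G : Set K) := by rwa [hG]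
  rw [Subalgebra.coe_algebraMap, ← Algebra.smul_def]
  change s • b ∈ (⊥ : Subalgebra D K)
  clear * - hb hsG
  induction hb using Submodule.span_induction with
  | mem c hc => exact hsG c hc
  | zero => simp
  | add c e _ _ hc he => rw [smul_add]; exact add_mem hc he
  | smul r c _ hc => rw [smul_comm]; exact Subalgebra.smul_mem _ hc _

/-- Over a seminormal domain, a factorisation of the constant terms of a rank one idempotent matrix of
polynomials extends to a factorisation of the matrix. -/
theorem IsSeminormalDomain.exists_factorization {σ : Type*}
    (hD : IsSeminormalDomain D) [IsFractionRing D K]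
    {M : Matrix (Fin 2) (Fin 2) (MvPolynomial σ D)} (hdet : M.det = 0) (htr : M.trace = 1)
    {x₀ y₀ : Fin 2 → D} (h₀ : ∀ i j, constantCoeff (M i j) = x₀ i * y₀ j) :
    ∃ x y : Fin 2 → MvPolynomial σ D, ∀ i j, M i j = x i * y j := by
  classical
  have hsum : ∑ i, x₀ i * y₀ i = 1 := by
    rw [Matrix.trace_fin_two] at htr
    rw [Fin.sum_univ_two, ← h₀, ← h₀, ← map_add, htr, map_one]
  have hinj := FaithfulSMul.algebraMap_injective D K
  obtain ⟨x, y, hxy, hx, hy⟩ := exists_factorization_of_field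
    (M := M.map (map (algebraMap D K)))
    (x₀ := fun i => algebraMap D K (x₀ i)) (y₀ := fun i => algebraMap D K (y₀ i))
    (by rw [← RingHom.mapMatrix_apply, ← RingHom.map_det, hdet, map_zero])
    (fun i j => by rw [Matrix.map_apply, constantCoeff_map, h₀, map_mul])
    (by simp only [← map_mul, ← map_sum, hsum, map_one])
  simp only [Matrix.map_apply] at hxy
  have hxint := isIntegral_coeff_of_factorization (m := fun i j => M i j)
    (fun i j => (hxy i j).symm) hy hsum
  have hyint := isIntegral_coeff_of_factorization (m := fun i j => M j i) (x := y) (y := x)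
    (x₀ := y₀) (y₀ := x₀) (fun i j => by rw [mul_comm, ← hxy j i]) hx
    (by simpa only [mul_comm] using hsum)
  let T : Set K := ⋃ i, ((x i).coeffs ∪ (y i).coeffs : Set K)
  have hTfin : T.Finite := Set.finite_iUnion fun i =>
    (Finset.finite_toSet _).union (Finset.finite_toSet _)
  have hTint : ∀ c ∈ T, IsIntegral D c := by
    intro c hc
    obtain ⟨i, hc | hc⟩ := Set.mem_iUnion.1 hc <;>
    obtain ⟨n, -, rfl⟩ := mem_coeffs_iff.1 (Finset.mem_coe.1 hc)
    · exact hxint i n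
    · exact hyint i n
  -- The finite overring of `D` generated by the coefficients; the goal is to show that it is `D`.
  let B := Algebra.adjoin D T
  have hlift : ∀ f : MvPolynomial σ K, (∀ c ∈ f.coeffs, c ∈ B) →
      ∃ g : MvPolynomial σ B, map (algebraMap B K) g = f := by
    intro f hf
    have : f ∈ Set.range (map (σ := σ) (algebraMap B K)) := by
      rw [mem_range_map_iff_coeffs_subset]
      intro c hc
      exact ⟨⟨c, hf c hc⟩, rfl⟩
    exact this
  choose X hX using fun i => hlift (x i) fun c hc =>
    Algebra.subset_adjoin (Set.mem_iUnion.2 ⟨i, Or.inl hc⟩)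
  choose Y hY using fun i => hlift (y i) fun c hc =>
    Algebra.subset_adjoin (Set.mem_iUnion.2 ⟨i, Or.inr hc⟩)
  have hBK : Function.Injective (algebraMap B K) := Subtype.val_injective
  have hXY : ∀ i j, X i * Y j = map (algebraMap D B) (M i j) := fun i j => by
    apply map_injective _ hBK
    rw [map_mul, hX, hY, ← hxy, map_map, ← IsScalarTower.algebraMap_eq]
  have hX0 : ∀ i, constantCoeff (X i) = algebraMap D B (x₀ i) := fun i => by
    apply hBK
    rw [← constantCoeff_map, hX, hx]; rfl
  have hY0 : ∀ i, constantCoeff (Y i) = algebraMap D B (y₀ i) := fun i => by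
    apply hBK
    rw [← constantCoeff_map, hY, hy]; rfl
  have htop : B.conductor.comap (algebraMap D B) = ⊤ := by
    by_contra hne
    obtain ⟨q, hq, hIq⟩ := Ideal.exists_le_maximal _ hne
    have := hq.isPrime
    obtain ⟨p, hp, -⟩ := Ideal.exists_minimalPrimes_le hIq
    have := hp.isPrime
    obtain ⟨s, hs, hsI⟩ := Subalgebra.exists_notMem_mem_conductor hTfin hTint p (by
      intro c hc
      obtain ⟨i, hc | hc⟩ := Set.mem_iUnion.1 hc <;>
      obtain ⟨n, -, rfl⟩ := mem_coeffs_iff.1 (Finset.mem_coe.1 hc)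
      · rw [← hX, coeff_map]
        exact hD.exists_smul_coeff_mem_bot hp hdet htr h₀ hXY hX0 i n
      · rw [← hY, coeff_map]
        exact hD.exists_smul_coeff_mem_bot (M := M.transpose) (x₀ := y₀) (y₀ := x₀) (y := X) hp
          (by rw [Matrix.det_transpose, hdet])
          (by rw [Matrix.trace_transpose, htr])
          (fun i j => by rw [Matrix.transpose_apply, h₀, mul_comm])
          (fun i j => by rw [mul_comm, hXY, Matrix.transpose_apply]) hY0 i n)
    exact hs (hp.1.2 hsI)
  have hbot : ∀ b : B, ∃ d, algebraMap D K d = b := fun b => by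
    have h1 : (1 : D) ∈ B.conductor.comap (algebraMap D B) := htop ▸ Submodule.mem_top
    have := Subalgebra.mem_conductor.1 (Ideal.mem_comap.1 h1) b
    simpa [Algebra.mem_bot] using this
  have hlift' : ∀ g : MvPolynomial σ B, ∃ f : MvPolynomial σ D,
      map (algebraMap D K) f = map (algebraMap B K) g := by
    intro g
    have : map (algebraMap B K) g ∈ Set.range (map (σ := σ) (algebraMap D K)) := by
      rw [mem_range_map_iff_coeffs_subset]
      intro c hc
      obtain ⟨n, -, rfl⟩ := mem_coeffs_iff.1 (Finset.mem_coe.1 hc)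
      obtain ⟨d, hd⟩ := hbot (g.coeff n)
      exact ⟨d, by rw [hd, coeff_map]; rfl⟩
    exact this
  choose x' hx' using fun i => hlift' (X i)
  choose y' hy' using fun i => hlift' (Y i)
  refine ⟨x', y', fun i j => ?_⟩
  apply map_injective _ hinj
  rw [map_mul, hx', hy', hX, hY, hxy]

end Conductor

/-! ### The two implications -/

theorem IsPRINCDomain.of_retract {R S : Type*} [CommRing R] [IsDomain R] [CommRing S]
    (hS : IsPRINCDomain S) (ι : R →+* S) (π : S →+* R) (h : ∀ r, π (ι r) = r) :
    IsPRINCDomain R := by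
  have := hS.toIsDomain
  rw [isPRINCDomain_iff_exists_factorization] at hS ⊢
  intro M htr hdet
  obtain ⟨x, y, hxy⟩ := hS (M.map ι)
    (by
      rw [Matrix.trace_fin_two] at htr
      rw [Matrix.trace_fin_two, Matrix.map_apply, Matrix.map_apply, ← map_add, htr, map_one])
    (by rw [← RingHom.mapMatrix_apply, ← RingHom.map_det, hdet, map_zero])
  exact ⟨fun i => π (x i), fun i => π (y i), fun i j => by
    rw [← map_mul, ← hxy, Matrix.map_apply, h]⟩

/-- If `a ^ 2 = b ^ 3`, then `c = a / b` is found as a coefficient in the factorisation of the matrix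
`(1 + c X, c² X²)ᵀ * ((1 - c X) (1 + c² X²), c² X²)`, whose entries involve only `c ^ 2 = b` and
`c ^ 3 = a`. -/
theorem IsSeminormalDomain.of_isPRINCDomain_mvPolynomial {D σ : Type*} [CommRing D] [IsDomain D]
    [Nonempty σ] (h : IsPRINCDomain (MvPolynomial σ D)) : IsSeminormalDomain D := by
  classical
  rw [isPRINCDomain_iff_exists_factorization] at h
  refine { exists_of_sq_eq_cube := fun a b hab => ?_ }
  obtain ⟨l⟩ := ‹Nonempty σ›
  by_cases hb0 : b = 0
  · refine ⟨0, ?_, by simp [hb0]⟩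
    rw [hb0, zero_pow three_ne_zero, sq_eq_zero_iff] at hab
    simp [hab]
  let K := FractionRing D
  let ι := algebraMap D K
  have hinj : Function.Injective ι := FaithfulSMul.algebraMap_injective D K
  have hb0' : ι b ≠ 0 := fun hb => hb0 (hinj (by rw [hb, map_zero]))
  have habK : ι a ^ 2 = ι b ^ 3 := by rw [← map_pow, ← map_pow, hab]
  obtain ⟨c, hc⟩ : ∃ c, c = ι a / ι b := ⟨_, rfl⟩
  have hc2 : ι b = c ^ 2 := by
    rw [hc, div_pow, habK, eq_div_iff (pow_ne_zero 2 hb0')]; ring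
  have hc3 : ι a = c ^ 3 := by
    rw [pow_succ, ← hc2, hc, mul_div_cancel₀ _ hb0']
  have hCab : (C a : MvPolynomial σ D) ^ 2 = C b ^ 3 := by rw [← C_pow, hab, C_pow]
  obtain ⟨x, y, hxy⟩ := h
    !![1 - C b ^ 2 * X l ^ 4, C b * X l ^ 2 + C a * X l ^ 3;
      (C b * X l ^ 2 - C a * X l ^ 3) * (1 + C b * X l ^ 2), C b ^ 2 * X l ^ 4]
    (by rw [Matrix.trace_fin_two]; simp)
    (by
      rw [Matrix.det_fin_two]
      simp only [Matrix.of_apply, Matrix.cons_val', Matrix.cons_val_zero, Matrix.cons_val_one,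
        Matrix.cons_val_fin_one]
      linear_combination (X l ^ 6 * (1 + C b * X l ^ 2)) * hCab)
  -- Rescale so that the constant terms are those of the factorisation over `K`.
  obtain ⟨x', y', hxy', hx', -⟩ := exists_factorization_constantCoeff_eq (x := x) (y := y)
    (x₀ := ![1, 0]) (y₀ := ![1, 0])
    (fun i j => by rw [← hxy]; fin_cases i <;> fin_cases j <;> simp)
    (by simp)
  have huniq := (factorization_unique
    (x := ![1 + C c * X l, C (c ^ 2) * X l ^ 2])
    (y := ![(1 - C c * X l) * (1 + C (c ^ 2) * X l ^ 2), C (c ^ 2) * X l ^ 2])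
    (x' := fun i => map ι (x' i)) (y' := fun i => map ι (y' i))
    (fun i j => by
      rw [← map_mul, hxy', ← hxy]
      fin_cases i <;> fin_cases j <;> simp [hc2, hc3] <;> ring)
    (by simp; ring)
    (fun i => by rw [constantCoeff_map, hx']; fin_cases i <;> simp)).1
  have hcD : ι ((x' 0).coeff (Finsupp.single l 1)) = c := by
    have := congrArg (coeff (Finsupp.single l 1)) (congrFun huniq 0)
    rw [coeff_map] at this
    rw [← this]
    simp [coeff_one, coeff_C_mul, eq_comm (a := (0 : σ →₀ ℕ))]
  exact ⟨_, hinj (by rw [map_pow, hcD, hc3]), hinj (by rw [map_pow, hcD, hc2])⟩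

theorem mainTheorem5 (D : Type*) [CommRing D] [IsDomain D] (Λ : Type*) [Nonempty Λ] :
    IsPRINCDomain (MvPolynomial Λ D) ↔ IsSeminormalDomain D ∧ IsPRINCDomain D := by
  refine ⟨fun h => ⟨.of_isPRINCDomain_mvPolynomial h,
    h.of_retract C constantCoeff fun r => constantCoeff_C Λ r⟩, fun ⟨hsemi, hD⟩ => ?_⟩
  rw [isPRINCDomain_iff_exists_factorization] at hD ⊢
  intro M htr hdet
  obtain ⟨x₀, y₀, h₀⟩ := hD (M.map constantCoeff)
    (by
      rw [Matrix.trace_fin_two] at htr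
      rw [Matrix.trace_fin_two, Matrix.map_apply, Matrix.map_apply, ← map_add, htr, map_one])
    (by rw [← RingHom.mapMatrix_apply, ← RingHom.map_det, hdet, map_zero])
  exact hsemi.exists_factorization (K := FractionRing D) hdet htr h₀
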